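/- An (oriented) virtual knot diagram $K$ is a generic smooth immersion of the oriented circle into the plane (its only multiple points are finitely many transverse double points), each double point of which is decorated either as a classical crossing, with an over strand and an under strand, or as a virtual crossing; $K$ is a classical knot diagram if it has no virtual crossings. Below, "crossing" means classical crossing. Each crossing $c$ has a sign $\mathrm{sgn}(c)\in\{+1,-1\}$ ($+1$ if the direction of the over strand is turned counterclockwise, through an angle less than $\pi$, to reach the direction of the under strand, $-1$ otherwise), and the writhe is $w(K)=\sum_{c}\mathrm{sgn}(c)$, the sum over all crossings. For a crossing $c$ let $K_c$ be the two-component link diagram obtained by smoothing $K$ at $c$ consistently with the orientation, let $L(K_c)$ be the sum of the signs of those crossings of $K_c$ that contain one strand from each of the two components, and let $\bar L(K_c)\in\{0,1\}$ be the residue of $L(K_c)$ modulo $2$. Put $$\gamma(K)=\sum_{c}\mathrm{sgn}(c)\,t^{\bar L(K_c)}\in\mathbb{Z}[t].$$ Proposition. For every virtual knot diagram $K$, evaluating $\gamma(K)$ at $t=1$ gives the writhe: $\gamma(K)|_{t=1}=w(K)$. If $K$ is a classical knot diagram, then $\gamma(K)=w(K)$ as polynomials, i.e. $\gamma(K)$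 is the constant polynomial $w(K)$. -/

import Mathlib

open scoped ContDiff

/-- The determinant of the pair of plane vectors `(v, w)`; the plane is identified with `ℂ`. -/
def planeDet (v w : ℂ) : ℝ := v.re * w.im - v.im * w.re

/-- A generic smooth immersion of the oriented circle `ℝ/ℤ` into the plane, written as a 1-periodic
map on `ℝ`: its only multiple points are finitely many transverse double points. The half-open
interval `[0, 1)` is used as the set of parameters of the points of the circle. -/
structure GenericClosedCurve where
  /-- the immersion -/
  curve : ℝ → ℂ
  periodic : Function.Periodic curve 1
  smooth : ContDiff ℝ ∞ curve
  immersion : ∀ t, deriv curve t ≠ 0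
  finite_double_points :
    {q : ℝ × ℝ | 0 ≤ q.1 ∧ q.1 < q.2 ∧ q.2 < 1 ∧ curve q.1 = curve q.2}.Finite
  no_triple_points : ∀ a ∈ Set.Ico (0 : ℝ) 1, ∀ b ∈ Set.Ico (0 : ℝ) 1, ∀ c ∈ Set.Ico (0 : ℝ) 1,
    curve a = curve b → curve b = curve c → a = b ∨ b = c ∨ a = c
  transverse : ∀ a ∈ Set.Ico (0 : ℝ) 1, ∀ b ∈ Set.Ico (0 : ℝ) 1, a ≠ b → curve a = curve b →
    planeDet (deriv curve a) (deriv curve b) ≠ 0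

/-- A double point of the curve, given by the parameters `first < second` at which the curve
passes through it. -/
structure GenericClosedCurve.DoublePoint (γ : GenericClosedCurve) where
  first : ℝ
  second : ℝ
  first_nonneg : 0 ≤ first
  first_lt_second : first < second
  second_lt_one : second < 1
  curve_eq : γ.curve first = γ.curve second

instance GenericClosedCurve.finite_doublePoint (γ : GenericClosedCurve) :
    Finite γ.DoublePoint := by
  have := γ.finite_double_points.to_subtype
  refine Finite.of_injective
    (β := {q : ℝ × ℝ | 0 ≤ q.1 ∧ q.1 < q.2 ∧ q.2 < 1 ∧ γ.curve q.1 = γ.curve q.2})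
    (fun d => ⟨(d.first, d.second),
      ⟨d.first_nonneg, d.first_lt_second, d.second_lt_one, d.curve_eq⟩⟩) ?_
  rintro ⟨a, b, _, _, _, _⟩ ⟨a', b', _, _, _, _⟩ h
  simp only [Subtype.mk.injEq, Prod.mk.injEq] at h
  obtain ⟨rfl, rfl⟩ := h
  rfl

/-- The decoration of a double point: either a classical crossing, where one of the two strands
passes over the other one, or a virtual crossing. -/
inductive CrossingKind where
  | firstOver
  | secondOver
  | virtual

/-- An oriented virtual knot diagram: a generic immersion of the circle into the plane, each double
point of which is decorated as a classical crossing (with over and under strands) or as a virtual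
crossing. -/
structure VirtualKnotDiagram extends GenericClosedCurve where
  kind : toGenericClosedCurve.DoublePoint → CrossingKind

namespace VirtualKnotDiagram

/-- A classical knot diagram is one without virtual crossings. -/
def IsClassical (K : VirtualKnotDiagram) : Prop :=
  ∀ d : K.DoublePoint, K.kind d ≠ CrossingKind.virtual

/-- The (classical) crossings of the diagram. -/
def Crossing (K : VirtualKnotDiagram) : Type :=
  {d : K.DoublePoint // K.kind d ≠ CrossingKind.virtual}

instance finite_crossing (K : VirtualKnotDiagram) : Finite K.Crossing :=
  inferInstanceAs (Finite {d : K.DoublePoint // K.kind d ≠ CrossingKind.virtual})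

noncomputable instance fintypeCrossing (K : VirtualKnotDiagram) : Fintype K.Crossing :=
  Fintype.ofFinite _

/-- The parameter of the overcrossing strand. -/
def overParam (K : VirtualKnotDiagram) (c : K.Crossing) : ℝ :=
  match K.kind c.1 with
  | CrossingKind.secondOver => c.1.second
  | _ => c.1.first

/-- The parameter of the undercrossing strand. -/
def underParam (K : VirtualKnotDiagram) (c : K.Crossing) : ℝ :=
  match K.kind c.1 with
  | CrossingKind.secondOver => c.1.first
  | _ => c.1.second

/-- The sign of a crossing: `+1` if the direction of the over strand is turned counterclockwise
(through an angle less than `π`) to reach the direction of the under strand, and `-1` otherwise. -/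
noncomputable def sgn (K : VirtualKnotDiagram) (c : K.Crossing) : ℤ :=
  SignType.sign
    (planeDet (deriv K.curve (K.overParam c)) (deriv K.curve (K.underParam c)))

/-- The writhe. -/
noncomputable def writhe (K : VirtualKnotDiagram) : ℤ := ∑ c : K.Crossing, K.sgn c

/-- Smoothing `c` vertically (the incoming end of each strand is joined to the outgoing end of the
other strand) cuts the knot into two closed components. This is the set of parameters of the
first one, which runs from the first passage through `c` to the second passage. -/
def component₁ (K : VirtualKnotDiagram) (c : K.Crossing) : Set ℝ :=
  Set.Ioo c.1.first c.1.second

/-- The set of parameters of the other component, which runs from the second passage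
through `c` to the first one, through the parameter `0`, which is identified with `1`. -/
def component₂ (K : VirtualKnotDiagram) (c : K.Crossing) : Set ℝ :=
  Set.Ico 0 c.1.first ∪ Set.Ioo c.1.second 1

/-- The crossings of the link `K_c` that contain one strand from each of its two components.
The crossings of `K_c` are the crossings of `K` other than `c`. -/
def mixedCrossings (K : VirtualKnotDiagram) (c : K.Crossing) : Set K.Crossing :=
  {d | (d.1.first ∈ K.component₁ c ∧ d.1.second ∈ K.component₂ c) ∨
       (d.1.first ∈ K.component₂ c ∧ d.1.second ∈ K.component₁ c)}

open Classical in
/-- The linking number `L(K_c)`: the sum of the signs of the crossings between the two components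
of `K_c`. The components inherit their orientations from `K`, so that the signs are the same. -/
noncomputable def linkingNumber (K : VirtualKnotDiagram) (c : K.Crossing) : ℤ :=
  ∑ d : K.Crossing with d ∈ K.mixedCrossings c, K.sgn d

/-- The residue of `L(K_c)` modulo 2, as one of the numbers `0` and `1`. -/
noncomputable def linkingParity (K : VirtualKnotDiagram) (c : K.Crossing) : ℕ :=
  (K.linkingNumber c % 2).toNat

/-- The polynomial `γ(K) = ∑ sgn(c) t ^ (L(K_c) mod 2)`, over all the crossings `c` of `K`. -/
noncomputable def gamma (K : VirtualKnotDiagram) : Polynomial ℤ :=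
  ∑ c : K.Crossing, Polynomial.C (K.sgn c) * Polynomial.X ^ K.linkingParity c

end VirtualKnotDiagram

/-! At `t = 1` the exponents do not matter, so all the content is that `L(K_c)` is even for a
classical diagram. Signs are odd, so `L(K_c)` has the parity of the number of mixed crossings.
Without virtual crossings these are exactly the common points, other than the crossing `c`, of the
two loops into which `c` cuts the curve; `even_card_common_points` shows that their number is even.

Let `γ s` run along the first loop, and let `W s` be the exponential of half the integral of `γ' /
(γ - γ s)` over the second loop: this is `(-1)` to the winding number of the second loop around `γ
s`. `W` is continuous off the common points and changes sign at each of them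
(`exp_half_integral_flips`). Near the corner the first loop leaves and returns on one side of a
line, while both ends of the second loop lie on the other side, so `W` has the same limit at both
ends of the first loop (`tendsto_exp_half_integral_corner`). Hence the number of sign changes is
even (`even_card_of_sign_flips`). -/

section

open Set Filter Topology

/-! ### Counting sign changes -/

/-- A function with square `1` off a finite set, which changes its sign at every point of the set
and has the same limits at both ends of the interval, changes its sign an even number of times. -/
theorem even_card_of_sign_flips {a b : ℝ} (hab : a < b) (Z : Finset ℝ) (hZ : ↑Z ⊆ Ioo a b)
    (g : ℝ → ℂ) (L₀ : ℂ) (hcont : ∀ s ∈ Ioo a b \ (Z : Set ℝ), ContinuousAt g s)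
    (hsq : ∀ s ∈ Ioo a b \ (Z : Set ℝ), g s ^ 2 = 1)
    (hflip : ∀ z ∈ Z, ∃ L, Tendsto g (𝓝[(Ioo a b \ (Z : Set ℝ)) ∩ Ioi z] z) (𝓝 L) ∧
      Tendsto g (𝓝[(Ioo a b \ (Z : Set ℝ)) ∩ Iio z] z) (𝓝 (-L)))
    (ha : Tendsto g (𝓝[Ioo a b \ (Z : Set ℝ)] a) (𝓝 L₀))
    (hb : Tendsto g (𝓝[Ioo a b \ (Z : Set ℝ)] b) (𝓝 L₀)) : Even Z.card := by
  classical
  set A : Set ℝ := Ioo a b \ (Z : Set ℝ) with hA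
  -- `N s` counts the flips strictly before `s`, so that `E` undoes the sign changes of `g`. `E`
  -- then extends continuously to `[a, b]` with square `1`, hence is constant there.
  set N : ℝ → ℕ := fun s => (Z.filter (· < s)).card with hN
  set E : ℝ → ℂ := fun s => g s * (-1) ^ N s with hE
  have hcl : Icc a b ⊆ closure A := by
    rw [← closure_Ioo hab.ne]
    refine closure_minimal ?_ isClosed_closure
    exact (Z.finite_toSet.countable.dense_compl ℝ).open_subset_closure_inter isOpen_Ioo
  have hsep : ∀ x : ℝ, ∀ᶠ s in 𝓝 x, ∀ y ∈ Z, y ≠ x → (y < s ↔ y < x) := by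
    intro x
    rw [Filter.eventually_all_finset]
    intro y _
    rcases lt_trichotomy y x with h | h | h
    · filter_upwards [lt_mem_nhds h] with s hs _
      simp [h, hs]
    · exact Eventually.of_forall fun s hs => absurd h hs
    · filter_upwards [gt_mem_nhds h] with s hs _
      exact iff_of_false (lt_asymm hs) (lt_asymm h)
  have hNnot : ∀ x ∉ Z, ∀ᶠ s in 𝓝 x, N s = N x := by
    intro x hx
    filter_upwards [hsep x] with s hs
    simp only [hN]
    congr 1
    refine Finset.filter_congr fun y hy => hs y hy ?_
    rintro rfl
    exact hx hy
  have hNleft : ∀ x, ∀ᶠ s in 𝓝 x, s < x → N s = N x := by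
    intro x
    filter_upwards [hsep x] with s hs hsx
    simp only [hN]
    congr 1
    refine Finset.filter_congr fun y hy => ?_
    by_cases hyx : y = x
    · subst hyx; simp [hsx.le]
    · exact hs y hy hyx
  have hNright : ∀ x ∈ Z, ∀ᶠ s in 𝓝 x, x < s → N s = N x + 1 := by
    intro x hx
    filter_upwards [hsep x] with s hs hsx
    simp only [hN]
    have : Z.filter (· < s) = insert x (Z.filter (· < x)) := by
      ext y
      simp only [Finset.mem_filter, Finset.mem_insert]
      by_cases hyx : y = x
      · subst hyx; simp [hsx, hx]
      · constructor
        · rintro ⟨h1, h2⟩; exact Or.inr ⟨h1, (hs y h1 hyx).1 h2⟩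
        · rintro (h | ⟨h1, h2⟩)
          · exact absurd h hyx
          · exact ⟨h1, (hs y h1 hyx).2 h2⟩
    rw [this, Finset.card_insert_of_notMem (by simp)]
  have htransfer : ∀ (l : Filter ℝ) (L : ℂ) (n : ℕ), Tendsto g l (𝓝 L) →
      (∀ᶠ s in l, N s = n) → Tendsto E l (𝓝 (L * (-1) ^ n)) := by
    intro l L n h1 h2
    refine (h1.mul_const ((-1) ^ n)).congr' ?_
    filter_upwards [h2] with s hs
    simp [hE, hs]
  have haZ : a ∉ Z := fun h => lt_irrefl _ (hZ h).1
  have hbZ : b ∉ Z := fun h => lt_irrefl _ (hZ h).2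
  have hNa : N a = 0 := by
    simp only [hN, Finset.card_eq_zero, Finset.filter_eq_empty_iff, not_lt]
    exact fun y hy => (hZ hy).1.le
  have hNb : N b = Z.card := by
    simp only [hN]
    rw [Finset.filter_true_of_mem fun y hy => (hZ hy).2]
  have hEa : Tendsto E (𝓝[A] a) (𝓝 L₀) := by
    simpa [hNa] using htransfer _ _ _ ha (nhdsWithin_le_nhds (hNnot a haZ))
  have hEb : Tendsto E (𝓝[A] b) (𝓝 (L₀ * (-1) ^ Z.card)) := by
    simpa [hNb] using htransfer _ _ _ hb (nhdsWithin_le_nhds (hNnot b hbZ))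
  have hlim : ∀ x ∈ Icc a b, ∃ y, Tendsto E (𝓝[A] x) (𝓝 y) := by
    intro x hx
    by_cases hxZ : x ∈ Z
    · obtain ⟨L, h1, h2⟩ := hflip x hxZ
      -- The flip at `x` itself is counted only to the right of `x`, where the limit is `L * (-1) ^
      -- (N x + 1)`; this equals the left limit.
      refine ⟨(-L) * (-1) ^ N x, ?_⟩
      have hun : A = (A ∩ Ioi x) ∪ (A ∩ Iio x) := by
        rw [← inter_union_distrib_left, Ioi_union_Iio, eq_comm, inter_eq_left]
        intro s hs h
        exact hs.2 (by rw [mem_singleton_iff.1 h]; exact hxZ)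
      rw [hun, nhdsWithin_union, tendsto_sup]
      constructor
      · have := htransfer _ _ (N x + 1) h1 (by
          filter_upwards [nhdsWithin_le_nhds (hNright x hxZ), self_mem_nhdsWithin] with s hs hs'
          exact hs hs'.2)
        convert this using 2
        ring
      · exact htransfer _ _ (N x) h2 (by
          filter_upwards [nhdsWithin_le_nhds (hNleft x), self_mem_nhdsWithin] with s hs hs'
          exact hs hs'.2)
    · rcases eq_or_lt_of_le hx.1 with rfl | hax
      · exact ⟨_, hEa⟩
      rcases eq_or_lt_of_le hx.2 with rfl | hxb
      · exact ⟨_, hEb⟩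
      exact ⟨_, htransfer _ _ (N x) ((hcont x ⟨⟨hax, hxb⟩, hxZ⟩).mono_left nhdsWithin_le_nhds)
        (nhdsWithin_le_nhds (hNnot x hxZ))⟩
  have hcE := continuousOn_extendFrom hcl hlim
  have hsqE : EqOn (extendFrom A E ^ 2) 1 (Icc a b) := by
    intro x hx
    have hne : (𝓝[A] x).NeBot := mem_closure_iff_nhdsWithin_neBot.1 (hcl hx)
    refine tendsto_nhds_unique ((tendsto_extendFrom (hlim x hx)).pow 2)
      (tendsto_const_nhds.congr' ?_)
    filter_upwards [self_mem_nhdsWithin] with s hs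
    simp [hE, mul_pow, hsq s hs, ← pow_mul, mul_comm _ 2]
  have heq : extendFrom A E a = extendFrom A E b := by
    have hma : a ∈ Icc a b := left_mem_Icc.2 hab.le
    have hmb : b ∈ Icc a b := right_mem_Icc.2 hab.le
    rcases isPreconnected_Icc.eq_one_or_eq_neg_one_of_sq_eq hcE hsqE with h | h <;>
      rw [h hma, h hmb] <;> rfl
  have h1 := extendFrom_eq (hcl (left_mem_Icc.2 hab.le)) hEa
  have h2 := extendFrom_eq (hcl (right_mem_Icc.2 hab.le)) hEb
  have h3 := hsqE (left_mem_Icc.2 hab.le)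
  simp only [Pi.pow_apply, Pi.one_apply, h1] at h3
  rw [h1, h2] at heq
  have hL : L₀ ≠ 0 := by rintro rfl; simp at h3
  have h4 : ((-1 : ℂ)) ^ Z.card = 1 := mul_left_cancel₀ hL (by rw [← heq, mul_one])
  exact (neg_one_pow_eq_one_iff_even (by norm_num)).1 h4

/-! ### Integrals of logarithmic derivatives -/

/-- The exponential of the integral of the logarithmic derivative of a nonvanishing function. -/
theorem exp_integral_logDeriv {f f' : ℝ → ℂ} (hf : ∀ t, HasDerivAt f (f' t) t)
    (hf' : Continuous f') {p q : ℝ} (hpq : p ≤ q) (h0 : ∀ t ∈ Icc p q, f t ≠ 0) :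
    Complex.exp (∫ t in p..q, f' t / f t) = f q / f p := by
  have hfc : Continuous f := continuous_iff_continuousAt.2 fun t => (hf t).continuousAt
  have hderiv : ∀ x ∈ Icc p q,
      HasDerivAt (fun y => ∫ t in p..y, f' t / f t) (f' x / f x) x := by
    intro x hx
    refine intervalIntegral.integral_hasDerivAt_right ?_ ?_ ?_
    · refine ContinuousOn.intervalIntegrable ?_
      rw [uIcc_of_le hx.1]
      exact hf'.continuousOn.div hfc.continuousOn fun t ht => h0 t ⟨ht.1, ht.2.trans hx.2⟩
    · exact (hf'.measurable.div hfc.measurable).stronglyMeasurable.stronglyMeasurableAtFilter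
    · exact hf'.continuousAt.div hfc.continuousAt (h0 x hx)
  have hD : ∀ x ∈ Icc p q,
      HasDerivAt (fun y => f y * Complex.exp (-∫ t in p..y, f' t / f t)) 0 x := by
    intro x hx
    refine ((hf x).mul (hderiv x hx).neg.cexp).congr_deriv ?_
    have := h0 x hx
    field_simp
    ring
  have := constant_of_has_deriv_right_zero (a := p) (b := q)
    (fun x hx => (hD x hx).continuousAt.continuousWithinAt)
    (fun x hx => (hD x ⟨hx.1, hx.2.le⟩).hasDerivWithinAt) q (right_mem_Icc.2 hpq)
  simp only [intervalIntegral.integral_same, neg_zero, Complex.exp_zero, mul_one] at this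
  rw [← this, Complex.exp_neg]
  have := h0 q (right_mem_Icc.2 hpq)
  field_simp [Complex.exp_ne_zero]

/-- The integral of the logarithmic derivative of a function which avoids a ray. -/
theorem integral_logDeriv_eq_log_sub {f f' : ℝ → ℂ} (hf : ∀ t, HasDerivAt f (f' t) t)
    (hf' : Continuous f') (κ : ℂ) {p q : ℝ} (hpq : p ≤ q)
    (h0 : ∀ t ∈ Icc p q, f t * κ ∈ Complex.slitPlane) :
    ∫ t in p..q, f' t / f t = Complex.log (f q * κ) - Complex.log (f p * κ) := by
  have hfc : Continuous f := continuous_iff_continuousAt.2 fun t => (hf t).continuousAt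
  have hne : ∀ t ∈ Icc p q, f t ≠ 0 := fun t ht h =>
    Complex.slitPlane_ne_zero (h0 t ht) (by rw [h, zero_mul])
  have hκ : κ ≠ 0 := fun h =>
    Complex.slitPlane_ne_zero (h0 p (left_mem_Icc.2 hpq)) (by rw [h, mul_zero])
  refine intervalIntegral.integral_eq_sub_of_hasDerivAt
    (f := fun t => Complex.log (f t * κ)) ?_ ?_
  · rw [uIcc_of_le hpq]
    intro x hx
    refine (((hf x).mul_const κ).clog_real (h0 x hx)).congr_deriv ?_
    have := hne x hx
    field_simp
  · refine ContinuousOn.intervalIntegrable ?_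
    rw [uIcc_of_le hpq]
    exact hf'.continuousOn.div hfc.continuousOn hne

/-- The integral of the logarithmic derivative depends continuously on the base point. -/
theorem continuousAt_integral_logDeriv {f f' : ℝ → ℂ} (hf : Continuous f) (hf' : Continuous f')
    {p q : ℝ} (hpq : p ≤ q) {z : ℂ} (hz : ∀ t ∈ Icc p q, f t ≠ z) :
    ContinuousAt (fun w => ∫ t in p..q, f' t / (f t - w)) z := by
  obtain ⟨t₀, ht₀, hmin⟩ := isCompact_Icc.exists_isMinOn (nonempty_Icc.2 hpq)
    (hf.sub (continuous_const (y := z))).norm.continuousOn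
  set d := ‖f t₀ - z‖ with hd
  have hd0 : 0 < d := norm_pos_iff.2 (sub_ne_zero.2 (hz t₀ ht₀))
  -- For `w` within `d / 2` of `z`, the denominators stay at least `d / 2` in norm.
  refine intervalIntegral.continuousAt_of_dominated_interval
    (bound := fun t => ‖f' t‖ / (d / 2)) ?_ ?_ ?_ ?_
  · exact Eventually.of_forall fun w =>
      (hf'.measurable.div (hf.sub continuous_const).measurable).aestronglyMeasurable
  · filter_upwards [Metric.ball_mem_nhds z (half_pos hd0)] with w hw
    refine Eventually.of_forall fun t ht => ?_
    rw [uIoc_of_le hpq] at ht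
    rw [norm_div]
    have h1 : d ≤ ‖f t - z‖ := hmin (Ioc_subset_Icc_self ht)
    have h2 : ‖f t - z‖ ≤ ‖f t - w‖ + ‖w - z‖ := by
      simpa using norm_add_le (f t - w) (w - z)
    rw [Metric.mem_ball, dist_eq_norm] at hw
    gcongr
    linarith
  · exact (hf'.norm.div_const _).intervalIntegrable _ _
  · refine Eventually.of_forall fun t ht => ?_
    rw [uIoc_of_le hpq] at ht
    exact continuousAt_const.div (continuousAt_const.sub continuousAt_id)
      (sub_ne_zero.2 (hz t (Ioc_subset_Icc_self ht)))

/-- Passing to the opposite branch changes the increment of the logarithm by `2πi` on a segment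
that crosses the real line. -/
theorem exp_half_log_neg_sub_log_neg {z w : ℂ} (h : z.im * w.im < 0) (c : ℂ) :
    Complex.exp ((c + (Complex.log (-z) - Complex.log (-w))) / 2) =
      -Complex.exp ((c + (Complex.log z - Complex.log w)) / 2) := by
  have hpos : ∀ x : ℂ, 0 < x.im → Complex.log (-x) = Complex.log x - Real.pi * Complex.I := by
    intro x hx
    simp only [Complex.log, norm_neg, Complex.arg_neg_eq_arg_sub_pi_of_im_pos hx]
    push_cast; ring
  have hneg : ∀ x : ℂ, x.im < 0 → Complex.log (-x) = Complex.log x + Real.pi * Complex.I := by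
    intro x hx
    simp only [Complex.log, norm_neg, Complex.arg_neg_eq_arg_add_pi_of_im_neg hx]
    push_cast; ring
  -- The points lie on opposite sides of the real axis, so their logarithms shift by opposite
  -- multiples of `πi`. The difference shifts by `2πi`, and half of it by `πi`.
  rcases mul_neg_iff.1 h with ⟨h1, h2⟩ | ⟨h1, h2⟩
  · rw [hpos z h1, hneg w h2, show (c + (Complex.log z - Real.pi * Complex.I -
      (Complex.log w + Real.pi * Complex.I))) / 2 =
      (c + (Complex.log z - Complex.log w)) / 2 - Real.pi * Complex.I by ring, Complex.exp_sub,
      Complex.exp_pi_mul_I]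
    ring
  · rw [hneg z h1, hpos w h2, show (c + (Complex.log z + Real.pi * Complex.I -
      (Complex.log w - Real.pi * Complex.I))) / 2 =
      (c + (Complex.log z - Complex.log w)) / 2 + Real.pi * Complex.I by ring, Complex.exp_add,
      Complex.exp_pi_mul_I]
    ring

/-! ### Local analysis at a transverse double point -/

/-- A real function with positive derivative at a point is increasing through that point. -/
theorem HasDerivAt.eventually_lt_and_lt_of_pos {h : ℝ → ℝ} {h' x : ℝ} (hh : HasDerivAt h h' x)
    (hpos : 0 < h') : ∀ᶠ y in 𝓝 x, (x < y → h x < h y) ∧ (y < x → h y < h x) := by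
  have := (hasDerivAt_iff_tendsto_slope.1 hh).eventually_const_lt hpos
  filter_upwards [eventually_nhdsWithin_iff.1 this] with y hy
  constructor
  · intro hxy
    have := hy hxy.ne'
    rw [slope_def_field, div_pos_iff_of_pos_right (sub_pos.2 hxy)] at this
    linarith
  · intro hxy
    have := hy hxy.ne
    rw [slope_def_field, ← neg_div_neg_eq, neg_sub, neg_sub,
      div_pos_iff_of_pos_right (sub_pos.2 hxy)] at this
    linarith

/-- Elementary estimate: a first-order perturbation of `τ r - σ`, with `r` not real and `σ > 0`,
is not a nonnegative real number. -/
theorem neg_mem_slitPlane_of_near {r F : ℂ} {τ σ ε : ℝ} (hr : r.im ≠ 0)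
    (hε : ε * (4 * (1 + |r.re| + |r.im|)) = |r.im|) (hσ : 0 < σ)
    (hF : ‖F - (τ * r - σ)‖ ≤ ε * (|τ| + σ)) : -F ∈ Complex.slitPlane := by
  rw [Complex.mem_slitPlane_iff]
  by_contra! hcon
  obtain ⟨h1, h2⟩ := hcon
  set m := |r.im| with hm
  set R := |r.re| with hR
  have hm0 : 0 < m := abs_pos.2 hr
  have hR0 : 0 ≤ R := abs_nonneg _
  have hK : 1 ≤ 1 + R + m := by linarith
  have hε0 : 0 < ε := by
    by_contra! h
    nlinarith
  have hε1 : ε ≤ 1 / 4 := by nlinarith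
  have him := (Complex.abs_im_le_norm _).trans hF
  have hre := (Complex.abs_re_le_norm _).trans hF
  simp only [Complex.neg_re, Complex.neg_im, Complex.sub_re, Complex.sub_im, Complex.mul_re,
    Complex.mul_im, Complex.ofReal_re, Complex.ofReal_im, zero_mul, sub_zero, add_zero] at *
  have h2' : F.im = 0 := by linarith
  rw [h2', zero_sub, abs_neg, abs_mul, ← hm] at him
  -- If `F` were real and nonnegative, its imaginary part would force `3 * (1 + R + m) * |τ| ≤ σ`.
  -- Then `|τ| * R` and the error are each at most `σ / 3`, so the real part of `F` is negative.
  have h3 : m * (4 * (1 + R + m) * |τ|) ≤ m * (|τ| + σ) := by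
    calc m * (4 * (1 + R + m) * |τ|) = (4 * (1 + R + m)) * (|τ| * m) := by ring
      _ ≤ (4 * (1 + R + m)) * (ε * (|τ| + σ)) := by gcongr
      _ = (ε * (4 * (1 + R + m))) * (|τ| + σ) := by ring
      _ = m * (|τ| + σ) := by rw [hε]
  have h4 := le_of_mul_le_mul_left h3 hm0
  have h5 : 0 ≤ |τ| := abs_nonneg _
  have h6 : |τ| ≤ (1 + R + m) * |τ| := by nlinarith
  have h7 : R * |τ| ≤ (1 + R + m) * |τ| := by gcongr; linarith
  have h8 : |τ * r.re| = |τ| * R := abs_mul _ _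
  have h9 := neg_abs_le (τ * r.re)
  have h10 := le_abs_self (τ * r.re)
  have h11 : ε * (|τ| + σ) ≤ 1 / 4 * (|τ| + σ) := by gcongr
  have h12 := (abs_le.1 hre).2
  nlinarith

/-- Dividing by `u` turns the first strand to the real direction; the imaginary part of `v / u` is
the determinant divided by `|u|²`. -/
theorem im_mul_inv_ne_zero_of_planeDet {u v : ℂ} (h : planeDet u v ≠ 0) : (v * u⁻¹).im ≠ 0 := by
  have hu : u ≠ 0 := by rintro rfl; simp [planeDet] at h
  have hn : Complex.normSq u ≠ 0 := by simpa using hu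
  have : (v * u⁻¹).im = planeDet u v / Complex.normSq u := by
    simp only [Complex.mul_im, Complex.inv_re, Complex.inv_im, planeDet]
    ring
  rw [this]
  exact div_ne_zero h hn

/-- Near a transverse double point `γ s₀ = γ t₀` the difference `γ t - γ s` avoids a ray, which
depends on the side of `s₀` on which `s` lies. -/
theorem exists_slitPlane_of_transverse {γ : ℝ → ℂ} {u v : ℂ} {s₀ t₀ : ℝ}
    (hs : HasDerivAt γ u s₀) (ht : HasDerivAt γ v t₀) (heq : γ s₀ = γ t₀)
    (hdet : planeDet u v ≠ 0) :
    ∃ δ > 0, ∀ s t, |s - s₀| ≤ δ → |t - t₀| ≤ δ →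
      (s₀ < s → -((γ t - γ s) * u⁻¹) ∈ Complex.slitPlane) ∧
      (s < s₀ → (γ t - γ s) * u⁻¹ ∈ Complex.slitPlane) ∧
      (t ≠ t₀ → 0 < ((γ t - γ s₀) * u⁻¹).im * ((t - t₀) * (v * u⁻¹).im)) := by
  have hu : u ≠ 0 := by rintro rfl; simp [planeDet] at hdet
  have hr := im_mul_inv_ne_zero_of_planeDet hdet
  set r := v * u⁻¹ with hrdef
  set K := 4 * (1 + |r.re| + |r.im|) with hK
  have hm0 : 0 < |r.im| := abs_pos.2 hr
  have hK0 : 0 < K := by positivity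
  set ε := |r.im| / K with hεdef
  have hε : ε * K = |r.im| := by rw [hεdef]; field_simp
  have hε0 : 0 < ε := by positivity
  have hs' := (hasDerivAt_iff_isLittleO.1 (hs.mul_const u⁻¹)).def hε0
  have ht' := (hasDerivAt_iff_isLittleO.1 (ht.mul_const u⁻¹)).def hε0
  rw [Metric.eventually_nhds_iff] at hs' ht'
  obtain ⟨δ₁, h1, hs'⟩ := hs'
  obtain ⟨δ₂, h2, ht'⟩ := ht'
  refine ⟨min δ₁ δ₂ / 2, by positivity, fun s t hsδ htδ => ?_⟩
  have hmin : 0 < min δ₁ δ₂ := lt_min h1 h2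
  have hbs := hs' (y := s) (by
    rw [Real.dist_eq]
    linarith [min_le_left δ₁ δ₂])
  have hbt := ht' (y := t) (by
    rw [Real.dist_eq]
    linarith [min_le_right δ₁ δ₂])
  simp only [mul_inv_cancel₀ hu, ← hrdef, Real.norm_eq_abs, Complex.real_smul, mul_one]
    at hbs hbt
  -- Subtracting the two first-order expansions at the common point, in the coordinate where `u`
  -- becomes `1`.
  have hF : ‖(γ t - γ s) * u⁻¹ - (((t - t₀ : ℝ) : ℂ) * r - ((s - s₀ : ℝ) : ℂ))‖ ≤
      ε * (|t - t₀| + |s - s₀|) := by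
    calc _ = ‖(γ t * u⁻¹ - γ t₀ * u⁻¹ - ((t - t₀ : ℝ) : ℂ) * r) -
          (γ s * u⁻¹ - γ s₀ * u⁻¹ - ((s - s₀ : ℝ) : ℂ))‖ := by rw [heq]; congr 1; ring
      _ ≤ _ := (norm_sub_le _ _).trans (by rw [mul_add]; exact add_le_add hbt hbs)
  refine ⟨fun hlt => ?_, fun hlt => ?_, fun hne => ?_⟩
  · rw [abs_of_pos (sub_pos.2 hlt)] at hF
    exact neg_mem_slitPlane_of_near hr hε (sub_pos.2 hlt) hF
  · have := neg_mem_slitPlane_of_near (F := -((γ t - γ s) * u⁻¹)) (τ := -(t - t₀))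
      (σ := -(s - s₀)) hr hε (by linarith) (by
        rw [abs_neg, ← abs_of_neg (sub_neg.2 hlt), ← norm_neg]
        refine le_of_eq_of_le (congrArg norm ?_) hF
        rw [abs_of_neg (sub_neg.2 hlt)]
        push_cast
        ring)
    rwa [neg_neg] at this
  · have him := (Complex.abs_im_le_norm _).trans hbt
    rw [← sub_mul, ← heq] at him
    simp only [Complex.sub_im, Complex.im_ofReal_mul] at him
    set y := ((γ t - γ s₀) * u⁻¹).im
    have hτ : 0 < |t - t₀| := abs_pos.2 (sub_ne_zero.2 hne)
    have hεm : ε < |r.im| := by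
      have : 4 ≤ K := by rw [hK]; nlinarith [abs_nonneg r.re]
      nlinarith
    have h3 : |y - (t - t₀) * r.im| < |(t - t₀) * r.im| := by
      rw [abs_mul]
      nlinarith
    have h4 := sq_lt_sq.2 h3
    nlinarith [sq_nonneg y]

/-! ### Jumps and corner limits of the winding sign -/

section

variable {γ γ' : ℝ → ℂ} {b c : ℝ} {S : Set ℝ}

/-- The integral of the logarithmic derivative of `γ - γ s` can be cut into three pieces. -/
theorem integral_logDeriv_split (hγ : Continuous γ) (hγ' : Continuous γ')
    (z : ℂ) (hz : ∀ t ∈ Icc b c, γ t ≠ z) {p q : ℝ} (hbp : b ≤ p) (hpq : p ≤ q) (hqc : q ≤ c) :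
    ∫ t in b..c, γ' t / (γ t - z) = (∫ t in b..p, γ' t / (γ t - z)) +
      (∫ t in p..q, γ' t / (γ t - z)) + ∫ t in q..c, γ' t / (γ t - z) := by
  have hint : ∀ x y, b ≤ x → x ≤ y → y ≤ c →
      IntervalIntegrable (fun t => γ' t / (γ t - z)) MeasureTheory.volume x y := by
    intro x y hx hxy hy
    refine ContinuousOn.intervalIntegrable ?_
    rw [uIcc_of_le hxy]
    exact hγ'.continuousOn.div (hγ.sub continuous_const).continuousOn fun t ht =>
      sub_ne_zero.2 (hz t ⟨hx.trans ht.1, ht.2.trans hy⟩)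
  rw [intervalIntegral.integral_add_adjacent_intervals (hint _ _ le_rfl hbp (hpq.trans hqc))
      (hint _ _ hbp hpq hqc),
    intervalIntegral.integral_add_adjacent_intervals (hint _ _ le_rfl (hbp.trans hpq) hqc)
      (hint _ _ (hbp.trans hpq) hqc le_rfl)]

/-- The square root of the exponential of the winding integral of the arc `γ|[b, c]` around `γ s`
changes its sign when `s` passes a transverse double point. -/
theorem exp_half_integral_flips (hγ : ∀ t, HasDerivAt γ (γ' t) t) (hγ' : Continuous γ')
    (hS : ∀ s ∈ S, ∀ t ∈ Icc b c, γ t ≠ γ s) {s₀ t₀ : ℝ} (ht₀ : t₀ ∈ Ioo b c)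
    (heq : γ s₀ = γ t₀) (huniq : ∀ t ∈ Icc b c, γ t = γ s₀ → t = t₀)
    (hdet : planeDet (γ' s₀) (γ' t₀) ≠ 0) :
    ∃ L, Tendsto (fun s => Complex.exp ((∫ t in b..c, γ' t / (γ t - γ s)) / 2))
        (𝓝[S ∩ Ioi s₀] s₀) (𝓝 L) ∧
      Tendsto (fun s => Complex.exp ((∫ t in b..c, γ' t / (γ t - γ s)) / 2))
        (𝓝[S ∩ Iio s₀] s₀) (𝓝 (-L)) := by
  obtain ⟨δ₀, hδ₀, hloc⟩ := exists_slitPlane_of_transverse (hγ s₀) (hγ t₀) heq hdet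
  have hγc : Continuous γ := continuous_iff_continuousAt.2 fun t => (hγ t).continuousAt
  set u := γ' s₀
  set r := γ' t₀ * u⁻¹
  obtain ⟨δ, hδ, hδ1, hδ2, hδ3⟩ : ∃ δ > 0, δ ≤ δ₀ ∧ b ≤ t₀ - δ ∧ t₀ + δ ≤ c := by
    refine ⟨min δ₀ (min (t₀ - b) (c - t₀)), lt_min hδ₀ (lt_min (by linarith [ht₀.1])
      (by linarith [ht₀.2])), min_le_left _ _, ?_, ?_⟩
    · have := (min_le_right δ₀ (min (t₀ - b) (c - t₀))).trans (min_le_left _ _)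
      linarith
    · have := (min_le_right δ₀ (min (t₀ - b) (c - t₀))).trans (min_le_right _ _)
      linarith
  set p := t₀ - δ with hp
  set q := t₀ + δ with hq
  have hpq : p ≤ q := by linarith
  -- The two outer pieces of the arc avoid `γ s₀`, so their contribution is continuous there; only
  -- the piece `[p, q]` can jump.
  set I : ℂ → ℂ := fun z => (∫ t in b..p, γ' t / (γ t - z)) + ∫ t in q..c, γ' t / (γ t - z)
  have hI : ContinuousAt I (γ s₀) := by
    refine (continuousAt_integral_logDeriv hγc hγ' hδ2 fun t ht h => ?_).add
      (continuousAt_integral_logDeriv hγc hγ' hδ3 fun t ht h => ?_)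
    · have := huniq t ⟨ht.1, by linarith [ht.2]⟩ h
      linarith [ht.2]
    · have := huniq t ⟨by linarith [ht.1], ht.2⟩ h
      linarith [ht.1]
  have hI' : Tendsto (fun s => I (γ s)) (𝓝 s₀) (𝓝 (I (γ s₀))) :=
    hI.tendsto.comp hγc.continuousAt
  have habs : |q - t₀| ≤ δ₀ ∧ |p - t₀| ≤ δ₀ := by
    rw [hp, hq, add_sub_cancel_left, sub_sub_cancel_left, abs_neg, abs_of_pos hδ]
    exact ⟨hδ1, hδ1⟩
  have hzq := (hloc s₀ q (by simpa using hδ₀.le) habs.1).2.2 (by linarith)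
  have hzp := (hloc s₀ p (by simpa using hδ₀.le) habs.2).2.2 (by linarith)
  rw [hq, add_sub_cancel_left, ← hq] at hzq
  rw [hp, sub_sub_cancel_left, ← hp] at hzp
  set zq := (γ q - γ s₀) * u⁻¹ with hzqd
  set zp := (γ p - γ s₀) * u⁻¹ with hzpd
  have him : zq.im * zp.im < 0 := by
    have h1 : 0 < zq.im * r.im := by
      have : 0 < δ * (zq.im * r.im) := by linarith
      exact (mul_pos_iff_of_pos_left hδ).1 this
    have h2 : zp.im * r.im < 0 := by
      have : 0 < δ * (-(zp.im * r.im)) := by linarith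
      have := (mul_pos_iff_of_pos_left hδ).1 this
      linarith
    have h3 : (zq.im * r.im) * (zp.im * r.im) < 0 := mul_neg_of_pos_of_neg h1 h2
    by_contra! h
    nlinarith [mul_nonneg h (sq_nonneg r.im)]
  have hq0 : zq.im ≠ 0 := left_ne_zero_of_mul him.ne
  have hp0 : zp.im ≠ 0 := right_ne_zero_of_mul him.ne
  have hnear : ∀ᶠ s in 𝓝 s₀, |s - s₀| ≤ δ₀ := by
    filter_upwards [Metric.closedBall_mem_nhds s₀ hδ₀] with s hs
    simpa [Real.dist_eq] using hs
  have hgen : ∀ (κ : ℂ) (l : Filter ℝ), l ≤ 𝓝 s₀ → (∀ᶠ s in l, s ∈ S) →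
      (∀ᶠ s in l, ∀ t ∈ Icc p q, (γ t - γ s) * κ ∈ Complex.slitPlane) →
      (γ q - γ s₀) * κ ∈ Complex.slitPlane → (γ p - γ s₀) * κ ∈ Complex.slitPlane →
      Tendsto (fun s => Complex.exp ((∫ t in b..c, γ' t / (γ t - γ s)) / 2)) l
        (𝓝 (Complex.exp ((I (γ s₀) + (Complex.log ((γ q - γ s₀) * κ) -
          Complex.log ((γ p - γ s₀) * κ))) / 2))) := by
    intro κ l hl hlS hslit hmq hmp
    have hlog : ∀ x, (γ x - γ s₀) * κ ∈ Complex.slitPlane →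
        Tendsto (fun s => Complex.log ((γ x - γ s) * κ)) l
          (𝓝 (Complex.log ((γ x - γ s₀) * κ))) := by
      intro x hx
      have : ContinuousAt (fun s => (γ x - γ s) * κ) s₀ := by fun_prop
      exact (this.tendsto.mono_left hl).clog hx
    refine (((hI'.mono_left hl).add ((hlog q hmq).sub (hlog p hmp))).div_const 2).cexp.congr' ?_
    filter_upwards [hlS, hslit] with s hsS hs
    rw [integral_logDeriv_split hγc hγ' (γ s) (hS s hsS) hδ2 hpq hδ3,
      integral_logDeriv_eq_log_sub (f := fun t => γ t - γ s) (fun t => (hγ t).sub_const _) hγ' κ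
        hpq hs]
    congr 1
    simp only [I]
    ring
  have htI : ∀ t ∈ Icc p q, |t - t₀| ≤ δ₀ := fun t ht =>
    abs_le.2 ⟨by linarith [ht.1], by linarith [ht.2]⟩
  -- The factor `κ = ∓u⁻¹` selects a logarithm branch valid on `[p, q]` for `s` to the right,
  -- respectively left, of `s₀`. By `him` the two branches give opposite values.
  refine ⟨_, hgen (-u⁻¹) _ nhdsWithin_le_nhds ?_ ?_ ?_ ?_, ?_⟩
  · filter_upwards [self_mem_nhdsWithin] with s hs using hs.1
  · filter_upwards [self_mem_nhdsWithin, nhdsWithin_le_nhds hnear] with s hs hs' t ht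
    rw [mul_neg]
    exact (hloc s t hs' (htI t ht)).1 hs.2
  · rw [mul_neg, ← hzqd, Complex.mem_slitPlane_iff]
    exact Or.inr (by simpa using hq0)
  · rw [mul_neg, ← hzpd, Complex.mem_slitPlane_iff]
    exact Or.inr (by simpa using hp0)
  · rw [mul_neg, mul_neg, ← hzqd, ← hzpd, exp_half_log_neg_sub_log_neg him, neg_neg]
    refine hgen u⁻¹ _ nhdsWithin_le_nhds ?_ ?_ ?_ ?_
    · filter_upwards [self_mem_nhdsWithin] with s hs using hs.1
    · filter_upwards [self_mem_nhdsWithin, nhdsWithin_le_nhds hnear] with s hs hs' t ht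
      exact (hloc s t hs' (htI t ht)).2.1 hs.2
    · exact Complex.mem_slitPlane_iff.2 (Or.inr hq0)
    · exact Complex.mem_slitPlane_iff.2 (Or.inr hp0)

/-- The limit of the winding integral of the closed arc `γ|[b, c]` around `γ s` when `γ s` tends
to the corner `γ b = γ c` from the outside of the corner. -/
theorem tendsto_exp_half_integral_corner (hγ : ∀ t, HasDerivAt γ (γ' t) t)
    (hγ' : Continuous γ') (hS : ∀ s ∈ S, ∀ t ∈ Icc b c, γ t ≠ γ s) {s₀ p q : ℝ} {P κ : ℂ}
    (hs₀ : γ s₀ = P) (hbc : γ b = γ c) (hbp : b ≤ p) (hpq : p ≤ q) (hqc : q ≤ c)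
    (hne : ∀ t ∈ Icc p q, γ t ≠ P)
    (hp : ∀ t ∈ Icc b p, 0 ≤ ((γ t - P) * κ).re) (hq : ∀ t ∈ Icc q c, 0 ≤ ((γ t - P) * κ).re)
    (hp0 : 0 < ((γ p - P) * κ).re) (hq0 : 0 < ((γ q - P) * κ).re)
    (hneg : ∀ᶠ s in 𝓝[S] s₀, ((γ s - P) * κ).re < 0) :
    Tendsto (fun s => Complex.exp ((∫ t in b..c, γ' t / (γ t - γ s)) / 2)) (𝓝[S] s₀)
      (𝓝 (Complex.exp ((Complex.log ((γ p - P) * κ) - Complex.log ((γ q - P) * κ) +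
        ∫ t in p..q, γ' t / (γ t - P)) / 2))) := by
  have hγc : Continuous γ := continuous_iff_continuousAt.2 fun t => (hγ t).continuousAt
  have hlog : ∀ x, 0 < ((γ x - P) * κ).re →
      Tendsto (fun s => Complex.log ((γ x - γ s) * κ)) (𝓝[S] s₀)
        (𝓝 (Complex.log ((γ x - P) * κ))) := by
    intro x hx
    have : ContinuousAt (fun s => (γ x - γ s) * κ) s₀ := by fun_prop
    have := this.tendsto
    rw [hs₀] at this
    exact (this.mono_left nhdsWithin_le_nhds).clog (Complex.mem_slitPlane_iff.2 (Or.inl hx))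
  have hI : Tendsto (fun s => ∫ t in p..q, γ' t / (γ t - γ s)) (𝓝[S] s₀)
      (𝓝 (∫ t in p..q, γ' t / (γ t - P))) := by
    have h1 := (continuousAt_integral_logDeriv hγc hγ' hpq hne).tendsto
    have h2 : Tendsto γ (𝓝[S] s₀) (𝓝 P) := hs₀ ▸ hγc.continuousAt.mono_left nhdsWithin_le_nhds
    exact h1.comp h2
  refine ((((hlog p hp0).sub (hlog q hq0)).add hI).div_const 2).cexp.congr' ?_
  filter_upwards [self_mem_nhdsWithin, hneg] with s hsS hs
  have hslit : ∀ t, 0 ≤ ((γ t - P) * κ).re → (γ t - γ s) * κ ∈ Complex.slitPlane := by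
    intro t ht
    refine Complex.mem_slitPlane_iff.2 (Or.inl ?_)
    rw [show (γ t - γ s) * κ = (γ t - P) * κ - (γ s - P) * κ by ring, Complex.sub_re]
    linarith
  -- The logarithms at `b` and `c` cancel since `γ b = γ c`; what remains has a limit depending on
  -- `P` but not on `s₀`.
  rw [integral_logDeriv_split hγc hγ' (γ s) (hS s hsS) hbp hpq hqc,
    integral_logDeriv_eq_log_sub (f := fun t => γ t - γ s) (fun t => (hγ t).sub_const _) hγ' κ
      hbp fun t ht => hslit t (hp t ht),
    integral_logDeriv_eq_log_sub (f := fun t => γ t - γ s) (fun t => (hγ t).sub_const _) hγ' κ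
      hqc fun t ht => hslit t (hq t ht), hbc]
  congr 1
  ring

end

/-! ### Parity of the common points of two loops -/

theorem exists_re_mul_pos_neg_of_planeDet {u v : ℂ} (h : planeDet u v ≠ 0) :
    ∃ κ : ℂ, 0 < (v * κ).re ∧ (u * κ).re < 0 := by
  have h' : u.re * v.im - u.im * v.re ≠ 0 := h
  -- Cramer's rule for `Re (v κ) = 1`, `Re (u κ) = -1`.
  refine ⟨⟨(-u.im - v.im) / (u.re * v.im - u.im * v.re),
    (-v.re - u.re) / (u.re * v.im - u.im * v.re)⟩, ?_, ?_⟩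
  · have : v.re * ((-u.im - v.im) / (u.re * v.im - u.im * v.re)) -
        v.im * ((-v.re - u.re) / (u.re * v.im - u.im * v.re)) = 1 := by
      rw [← mul_div_assoc, ← mul_div_assoc, ← sub_div, div_eq_iff h']; ring
    rw [Complex.mul_re, this]
    exact one_pos
  · have : u.re * ((-u.im - v.im) / (u.re * v.im - u.im * v.re)) -
        u.im * ((-v.re - u.re) / (u.re * v.im - u.im * v.re)) = -1 := by
      rw [← mul_div_assoc, ← mul_div_assoc, ← sub_div, div_eq_iff h']; ring
    rw [Complex.mul_re, this]
    norm_num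

/-- The two loops `γ|[a, b]` and `γ|[b, c]` of a closed curve at a transverse double point
`γ a = γ b = γ c` have an even number of other common points, if all these are transverse. -/
theorem even_card_common_points {γ γ' : ℝ → ℂ} (hγ : ∀ t, HasDerivAt γ (γ' t) t)
    (hγ' : Continuous γ') {a b c : ℝ} (hab : a < b) (hbc : b < c) (hγab : γ a = γ b)
    (hγca : γ c = γ a) (hγca' : γ' c = γ' a) (hcorner : planeDet (γ' a) (γ' b) ≠ 0)
    (h₁ : ∀ s ∈ Ioo a b, γ s ≠ γ a) (h₂ : ∀ t ∈ Ioo b c, γ t ≠ γ a)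
    (hinj : ∀ s ∈ Ioo a b, ∀ t ∈ Ioo b c, ∀ t' ∈ Ioo b c, γ s = γ t → γ s = γ t' → t = t')
    (hdet : ∀ s ∈ Ioo a b, ∀ t ∈ Ioo b c, γ s = γ t → planeDet (γ' s) (γ' t) ≠ 0)
    (Z : Finset ℝ) (hZ : ∀ s, s ∈ Z ↔ s ∈ Ioo a b ∧ ∃ t ∈ Ioo b c, γ s = γ t) :
    Even Z.card := by
  have hγc : Continuous γ := continuous_iff_continuousAt.2 fun t => (hγ t).continuousAt
  set S : Set ℝ := Ioo a b \ (Z : Set ℝ) with hSdef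
  have hend : ∀ s ∈ Ioo a b, ∀ t ∈ Icc b c, γ t = γ s → t ∈ Ioo b c := by
    intro s hs t ht h
    refine ⟨lt_of_le_of_ne ht.1 ?_, lt_of_le_of_ne ht.2 ?_⟩
    · rintro rfl
      exact h₁ s hs (by rw [← h, hγab])
    · rintro rfl
      exact h₁ s hs (by rw [← h, hγca])
  have hS : ∀ s ∈ S, ∀ t ∈ Icc b c, γ t ≠ γ s := fun s hs t ht h =>
    hs.2 ((hZ s).2 ⟨hs.1, t, hend s hs.1 t ht h, h.symm⟩)
  -- `h` below decreases through `a` and `c` and increases through `b`. So near the corner the first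
  -- loop has `h < 0` and the second has `h > 0`.
  obtain ⟨κ, hκb, hκa⟩ := exists_re_mul_pos_neg_of_planeDet hcorner
  set P := γ a with hP
  set h : ℝ → ℝ := fun t => ((γ t - P) * κ).re with hh
  have hder : ∀ t, HasDerivAt h (γ' t * κ).re t := fun t =>
    Complex.reCLM.hasFDerivAt.comp_hasDerivAt t (((hγ t).sub_const P).mul_const κ)
  have ha0 : h a = 0 := by simp [hh, hP]
  have hb0 : h b = 0 := by simp [hh, ← hγab]
  have hc0 : h c = 0 := by simp [hh, hγca]
  have hneg : ∀ x, (γ' x * κ).re < 0 →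
      ∀ᶠ y in 𝓝 x, (x < y → h y < h x) ∧ (y < x → h x < h y) := by
    intro x hx
    filter_upwards [(hder x).neg.eventually_lt_and_lt_of_pos (neg_pos.2 hx)] with y hy
    simpa using hy
  have hnb := (hder b).eventually_lt_and_lt_of_pos hκb
  have hna := hneg a hκa
  have hnc := hneg c (by rwa [hγca'])
  obtain ⟨εb, hεb, hb⟩ := Metric.eventually_nhds_iff.1 hnb
  obtain ⟨εc, hεc, hc⟩ := Metric.eventually_nhds_iff.1 hnc
  obtain ⟨δ, hδ, hδb, hδc, hδ2⟩ : ∃ δ > 0, δ < εb ∧ δ < εc ∧ 2 * δ < c - b := by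
    have : 0 < min εb (min εc (c - b)) := lt_min hεb (lt_min hεc (by linarith))
    have h1 := min_le_left εb (min εc (c - b))
    have h2 := (min_le_right εb (min εc (c - b))).trans (min_le_left _ _)
    have h3 := (min_le_right εb (min εc (c - b))).trans (min_le_right _ _)
    exact ⟨min εb (min εc (c - b)) / 3, by positivity, by linarith, by linarith, by linarith⟩
  have hposb : ∀ t ∈ Ioc b (b + δ), 0 < h t := by
    intro t ht
    rw [← hb0]
    refine (hb ?_).1 ht.1
    rw [Real.dist_eq, abs_of_pos (by linarith [ht.1])]
    linarith [ht.2]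
  have hposc : ∀ t ∈ Ico (c - δ) c, 0 < h t := by
    intro t ht
    rw [← hc0]
    refine (hc ?_).2 ht.2
    rw [Real.dist_eq, abs_of_neg (by linarith [ht.2])]
    linarith [ht.1]
  -- The limit left as `_` is independent of `s₀`, so it serves as the common limit `L₀` at `a` and
  -- `b`.
  have hlim : ∀ s₀, γ s₀ = P → (∀ᶠ s in 𝓝[S] s₀, h s < 0) → _ := fun s₀ hs₀ hs =>
    tendsto_exp_half_integral_corner (p := b + δ) (q := c - δ) (κ := κ) hγ hγ' hS hs₀
      (by rw [hγca, hγab]) (by linarith) (by linarith) (by linarith)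
      (fun t ht => h₂ t ⟨by linarith [ht.1], by linarith [ht.2]⟩)
      (fun t ht => by
        rcases eq_or_lt_of_le ht.1 with rfl | hlt
        · exact hb0.ge
        · exact (hposb t ⟨hlt, ht.2⟩).le)
      (fun t ht => by
        rcases eq_or_lt_of_le ht.2 with rfl | hlt
        · exact hc0.ge
        · exact (hposc t ⟨ht.1, hlt⟩).le)
      (hposb _ ⟨by linarith, le_rfl⟩) (hposc _ ⟨le_rfl, by linarith⟩) hs
  refine even_card_of_sign_flips hab Z (fun s hs => ((hZ s).1 hs).1)
    (fun s => Complex.exp ((∫ t in b..c, γ' t / (γ t - γ s)) / 2)) _ ?_ ?_ ?_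
    (hlim a rfl ?_) (hlim b hγab.symm ?_)
  · intro s hs
    have := (continuousAt_integral_logDeriv hγc hγ' hbc.le (hS s hs)).comp
      (f := γ) (x := s) hγc.continuousAt
    exact (this.div_const 2).cexp
  · intro s hs
    -- The square is the exponential of the full integral, `(γ c - γ s) / (γ b - γ s) = 1`, because
    -- the loop is closed.
    rw [← Complex.exp_nat_mul]
    have := exp_integral_logDeriv (f := fun t => γ t - γ s) (fun t => (hγ t).sub_const _) hγ'
      hbc.le fun t ht => sub_ne_zero.2 (hS s hs t ht)
    rw [Nat.cast_ofNat, mul_div_cancel₀ _ two_ne_zero, this, hγca, ← hγab, div_self]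
    exact sub_ne_zero.2 (h₁ s hs.1).symm
  · intro z hz
    obtain ⟨hz1, t₀, ht₀, heq⟩ := (hZ z).1 hz
    exact exp_half_integral_flips hγ hγ' hS ht₀ heq
      (fun t ht h => hinj z hz1 t (hend z hz1 t ht h) t₀ ht₀ h.symm heq) (hdet z hz1 t₀ ht₀ heq)
  · filter_upwards [self_mem_nhdsWithin, nhdsWithin_le_nhds hna] with s hs hs'
    rw [← ha0]
    exact hs'.1 hs.1.1
  · filter_upwards [self_mem_nhdsWithin, nhdsWithin_le_nhds hnb] with s hs hs'
    rw [← hb0]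
    exact hs'.2 hs.1.2

/-! ### Application to knot diagrams -/

namespace VirtualKnotDiagram

/-- Transversality makes the determinant nonzero in either order of the strands, so the sign is
`±1`. -/
theorem odd_sgn (K : VirtualKnotDiagram) (c : K.Crossing) : Odd (K.sgn c) := by
  have h1 := K.transverse c.1.first ⟨c.1.first_nonneg, c.1.first_lt_second.trans
    c.1.second_lt_one⟩ c.1.second ⟨c.1.first_nonneg.trans c.1.first_lt_second.le,
    c.1.second_lt_one⟩ c.1.first_lt_second.ne c.1.curve_eq
  have h2 : planeDet (deriv K.curve (K.overParam c)) (deriv K.curve (K.underParam c)) ≠ 0 := by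
    have hswap : planeDet (deriv K.curve c.1.second) (deriv K.curve c.1.first) ≠ 0 := by
      intro h
      apply h1
      simp only [planeDet] at h ⊢
      linarith
    unfold overParam underParam
    split <;> assumption
  unfold sgn
  rcases lt_or_gt_of_ne h2 with h | h
  · simp [sign_neg h]
  · simp [sign_pos h]

/-- In a classical diagram an even number of crossings is interlaced with a given crossing. -/
theorem even_ncard_mixedCrossings (K : VirtualKnotDiagram) (hK : K.IsClassical)
    (c : K.Crossing) : Even (K.mixedCrossings c).ncard := by
  classical
  set a := c.1.first with ha
  set b := c.1.second with hb
  have ha0 : 0 ≤ a := c.1.first_nonneg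
  have hab : a < b := c.1.first_lt_second
  have hb1 : b < 1 := c.1.second_lt_one
  have hγab : K.curve a = K.curve b := c.1.curve_eq
  have hper : ∀ t, K.curve (t + 1) = K.curve t := K.periodic
  have hper' : ∀ t, deriv K.curve (t + 1) = deriv K.curve t := by
    intro t
    rw [← deriv_comp_add_const]
    exact congrArg (fun f => deriv f t) (funext hper)
  -- the representative in `[0, 1)` of a parameter between `b` and `a + 1`
  have hrep : ∀ t ∈ Ioo b (a + 1), ∃ t' ∈ Ico (0 : ℝ) 1, K.curve t' = K.curve t ∧
      deriv K.curve t' = deriv K.curve t ∧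
      ((b < t' ∧ t' = t) ∨ (t' < a ∧ t = t' + 1)) := by
    intro t ht
    rcases lt_or_ge t 1 with h | h
    · exact ⟨t, ⟨by linarith [ht.1], h⟩, rfl, rfl, Or.inl ⟨ht.1, rfl⟩⟩
    · refine ⟨t - 1, ⟨by linarith, by linarith [ht.2]⟩, ?_, ?_, Or.inr ⟨by linarith [ht.2], ?_⟩⟩
      · rw [← hper (t - 1), sub_add_cancel]
      · rw [← hper' (t - 1), sub_add_cancel]
      · ring
  have hma : a ∈ Ico (0 : ℝ) 1 := ⟨ha0, hab.trans hb1⟩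
  have hmb : b ∈ Ico (0 : ℝ) 1 := ⟨ha0.trans hab.le, hb1⟩
  have hms : ∀ s ∈ Ioo a b, s ∈ Ico (0 : ℝ) 1 := fun s hs =>
    ⟨ha0.trans hs.1.le, hs.2.trans hb1⟩
  have hthird : ∀ s ∈ Ico (0 : ℝ) 1, s ≠ a → s ≠ b → K.curve s ≠ K.curve a := by
    intro s hs hsa hsb h
    rcases K.no_triple_points s hs a hma b hmb h hγab with h | h | h
    · exact hsa h
    · exact hab.ne h
    · exact hsb h
  -- the parameter of a mixed crossing that lies on the first component
  let φ : K.Crossing → ℝ := fun d => if d.1.first ∈ K.component₁ c then d.1.first else d.1.second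
  have hφ : ∀ d ∈ K.mixedCrossings c, φ d ∈ Ioo a b ∧
      ∃ t ∈ Ioo b (a + 1), K.curve (φ d) = K.curve t ∧
        ((φ d = d.1.first ∧ t = d.1.second) ∨ (φ d = d.1.second ∧ t = d.1.first + 1)) := by
    intro d hd
    have hd1 := d.1.first_lt_second
    rcases hd with ⟨h1, h2⟩ | ⟨h1, h2⟩
    · have hφd : φ d = d.1.first := if_pos h1
      rw [hφd]
      refine ⟨h1, d.1.second, ?_, d.1.curve_eq, Or.inl ⟨rfl, rfl⟩⟩
      rcases h2 with h2 | h2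
      · have := h1.1
        have := h2.2
        linarith
      · exact ⟨h2.1, by linarith [h2.2]⟩
    · have h3 : d.1.first < a := by
        rcases h1 with h1 | h1
        · exact h1.2
        · have := h1.1
          have := h2.2
          linarith
      have hφd : φ d = d.1.second := if_neg fun h => lt_asymm h3 h.1
      rw [hφd]
      refine ⟨h2, d.1.first + 1, ⟨?_, by linarith⟩, ?_, Or.inr ⟨rfl, rfl⟩⟩
      · linarith [d.1.first_nonneg]
      · rw [hper, d.1.curve_eq]
  -- Two distinct such parameters would give a triple point.
  have huniq : ∀ s ∈ Ioo a b, ∀ t ∈ Ioo b (a + 1), ∀ t' ∈ Ioo b (a + 1),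
      K.curve s = K.curve t → K.curve s = K.curve t' → t = t' := by
    intro s hs t ht t' ht' h h'
    obtain ⟨x, hx, hxγ, -, hxt⟩ := hrep t ht
    obtain ⟨x', hx', hxγ', -, hxt'⟩ := hrep t' ht'
    rcases K.no_triple_points s (hms s hs) x hx x' hx' (h.trans hxγ.symm)
      (hxγ.trans (h.symm.trans (h'.trans hxγ'.symm))) with e | e | e
    · rcases hxt with ⟨h1, -⟩ | ⟨h1, -⟩ <;> linarith [hs.1, hs.2]
    · rcases hxt with ⟨h1, h2⟩ | ⟨h1, h2⟩ <;> rcases hxt' with ⟨h3, h4⟩ | ⟨h3, h4⟩ <;> linarith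
    · rcases hxt' with ⟨h1, -⟩ | ⟨h1, -⟩ <;> linarith [hs.1, hs.2]
  have hφinj : InjOn φ (K.mixedCrossings c) := by
    intro d hd e he hde
    obtain ⟨h1, t, ht, hγt, h2⟩ := hφ d hd
    obtain ⟨-, t', ht', hγt', h2'⟩ := hφ e he
    rw [← hde] at hγt' h2'
    have htt := huniq _ h1 t ht t' ht' hγt hγt'
    have hd1 := d.1.first_lt_second
    have hd2 := d.1.second_lt_one
    have hd3 := d.1.first_nonneg
    have he1 := e.1.first_lt_second
    have he2 := e.1.second_lt_one
    have he3 := e.1.first_nonneg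
    have hfs : d.1.first = e.1.first ∧ d.1.second = e.1.second := by
      rcases h2 with ⟨h3, h4⟩ | ⟨h3, h4⟩ <;> rcases h2' with ⟨h5, h6⟩ | ⟨h5, h6⟩ <;>
        constructor <;> linarith
    obtain ⟨⟨x, y, _, _, _, _⟩, _⟩ := d
    obtain ⟨⟨x', y', _, _, _, _⟩, _⟩ := e
    obtain ⟨rfl, rfl⟩ := hfs
    rfl
  -- Classicality enters here: every common point of the loops is a genuine crossing.
  have hsurj : ∀ s ∈ Ioo a b, ∀ t ∈ Ioo b (a + 1), K.curve s = K.curve t →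
      ∃ d ∈ K.mixedCrossings c, φ d = s := by
    intro s hs t ht h
    obtain ⟨x, hx, hxγ, -, hxt⟩ := hrep t ht
    have hsx := h.trans hxγ.symm
    rcases hxt with ⟨h1, -⟩ | ⟨h1, -⟩
    · let d : K.DoublePoint := ⟨s, x, (hms s hs).1, hs.2.trans h1, hx.2, hsx⟩
      exact ⟨⟨d, hK d⟩, Or.inl ⟨hs, Or.inr ⟨h1, hx.2⟩⟩, if_pos hs⟩
    · let d : K.DoublePoint := ⟨x, s, hx.1, h1.trans hs.1, (hms s hs).2, hsx.symm⟩
      exact ⟨⟨d, hK d⟩, Or.inr ⟨Or.inl ⟨hx.1, h1⟩, hs⟩, if_neg fun h => lt_asymm h1 h.1⟩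
  have hfin : (φ '' K.mixedCrossings c).Finite := (toFinite _).image φ
  rw [← hφinj.ncard_image, ncard_eq_toFinset_card _ hfin]
  have hdiff : Differentiable ℝ K.curve := K.smooth.differentiable (by simp)
  -- By periodicity the second component is the single arc `[b, a + 1]`.
  refine even_card_common_points (γ := K.curve) (γ' := deriv K.curve) (a := a) (b := b)
    (c := a + 1) (fun t => (hdiff t).hasDerivAt) (K.smooth.continuous_deriv (by simp)) hab
    (by linarith) hγab (hper a) (hper' a) (K.transverse a hma b hmb hab.ne hγab) ?_ ?_ huniq ?_
    _ ?_
  · exact fun s hs => hthird s (hms s hs) hs.1.ne' hs.2.ne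
  · intro t ht
    obtain ⟨x, hx, hxγ, -, hxt⟩ := hrep t ht
    rw [← hxγ]
    rcases hxt with ⟨h1, -⟩ | ⟨h1, -⟩
    · exact hthird x hx (hab.trans h1).ne' h1.ne'
    · exact hthird x hx h1.ne (h1.trans hab).ne
  · intro s hs t ht h
    obtain ⟨x, hx, hxγ, hxγ', hxt⟩ := hrep t ht
    rw [← hxγ']
    refine K.transverse s (hms s hs) x hx ?_ (h.trans hxγ.symm)
    rintro rfl
    rcases hxt with ⟨h1, -⟩ | ⟨h1, -⟩ <;> linarith [hs.1, hs.2]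
  · intro s
    simp only [Finite.mem_toFinset, mem_image]
    constructor
    · rintro ⟨d, hd, rfl⟩
      obtain ⟨h1, t, ht, h2, -⟩ := hφ d hd
      exact ⟨h1, t, ht, h2⟩
    · rintro ⟨hs, t, ht, h⟩
      exact hsurj s hs t ht h

theorem linkingParity_eq_zero (K : VirtualKnotDiagram) (hK : K.IsClassical) (c : K.Crossing) :
    K.linkingParity c = 0 := by
  classical
  have h1 : Even (K.linkingNumber c) := by
    have h2 := K.even_ncard_mixedCrossings hK c
    rw [ncard_eq_toFinset_card', ← filter_mem_univ_eq_toFinset] at h2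
    -- Each sign is congruent to `1` modulo `2`, so the linking number has the parity of the number
    -- of mixed crossings.
    have h3 : Even (∑ d : K.Crossing with d ∈ K.mixedCrossings c, (K.sgn d - 1)) :=
      Finset.even_sum _ fun d _ => (K.odd_sgn d).sub_odd odd_one
    rw [Finset.sum_sub_distrib, Finset.sum_const, nsmul_one] at h3
    have h4 := h3.add ((Int.even_coe_nat _).2 h2)
    rwa [sub_add_cancel] at h4
  unfold linkingParity
  rw [Int.even_iff.1 h1]
  rfl

end VirtualKnotDiagram

end

theorem mainTheorem5 :
    (∀ K : VirtualKnotDiagram, Polynomial.eval 1 K.gamma = K.writhe) ∧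
    (∀ K : VirtualKnotDiagram, K.IsClassical → K.gamma = Polynomial.C K.writhe) := by
  refine ⟨fun K => ?_, fun K hK => ?_⟩
  · simp [VirtualKnotDiagram.gamma, VirtualKnotDiagram.writhe, Polynomial.eval_finsetSum]
  · simp [VirtualKnotDiagram.gamma, VirtualKnotDiagram.writhe, K.linkingParity_eq_zero hK]
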